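/- Let $a,b\in\mathbb C$ with $b\notin\{0,-1,-2,\dots\}$, and let $$w(z)={}_1F_1(a;b;z)=\sum_{n=0}^\infty\frac{(a)_n}{(b)_n}\frac{z^n}{n!},\qquad (x)_n=x(x+1)\cdots(x+n-1),$$ be the confluent hypergeometric function. Let $z_k$ run over the (finitely or infinitely many) zeros of $w$ in $\mathbb C$, and put $S_p=\sum_k z_k^{-p}$. All zeros of $w$ are simple, and the series $S_p$ converges absolutely for every integer $p\ge 2$. Moreover $$S_2=\frac{a(a-b)}{b^2(b+1)},\qquad S_3=\frac{a(a-b)(b-2a)}{b^3(b+1)(b+2)},$$ and, for every integer $k\ge 3$, $$S_{k+1}=\frac1{b(k+b)}\left[(b-2a)S_k+b\sum_{m=2}^{k-1}S_mS_{k-m+1}\right].$$ In particular, $$S_4=\frac{a(a-b)\left[a(a-b)(5b+6)+b^2(b+1)\right]}{b^4(b+1)^2(b+2)(b+3)}.$$ -/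

import Mathlib

/-- Kummer's confluent hypergeometric function
`₁F₁(a; b; z) = ∑ (a)_n / (b)_n * z ^ n / n!`, where `(x)_n = x (x + 1) ⋯ (x + n - 1)` is the
rising factorial. It is meant for `b ∉ {0, -1, -2, …}`. -/
noncomputable def kummerM (a b z : ℂ) : ℂ :=
  ∑' n : ℕ, (ascPochhammer ℂ n).eval a / (ascPochhammer ℂ n).eval b * (z ^ n / (n.factorial : ℂ))

/-- The set of complex zeros of `z ↦ ₁F₁(a; b; z)`. -/
def kummerZeros (a b : ℂ) : Set ℂ := {z | kummerM a b z = 0}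

/-- `S_p = ∑ z_k ^ (-p)`, the sum over all the zeros `z_k` of `₁F₁(a; b; ·)`. -/
noncomputable def kummerS (a b : ℂ) (p : ℕ) : ℂ :=
  ∑' z : kummerZeros a b, (z : ℂ) ^ (-(p : ℤ))

/-! Let `U` be the Taylor series of `w'/w` at `0`. Dividing Kummer's equation `z w'' + (b - z) w' -
a w = 0` by `w` gives the Riccati equation `X (U' + U²) + (b - X) U = a`, whose coefficients yield a
quadratic recursion (`exists_kummer_riccati`). With `U₀ = a / b` and `Uₙ = -S_{n+1}` for `n ≥ 1`, it
becomes the stated one.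

The identity `Uₙ = -S_{n+1}` (`tsum_zpow_zeros_eq_neg_coeff`) needs only exponential type and simple
zeros, and no Hadamard factorization. Divide `w` by `∏ (1 - z / s)` over the zeros in `|z| ≤ R`. By
the maximum principle the quotient `g` is at most `exp (3CR)` on the disc, where its logarithm is
holomorphic; Borel–Carathéodory and Cauchy bound the `n`-th coefficient of `g'/g` by `O(R^{-n})`,
which tends to `0` if `n ≥ 1`. The same maximum principle at `z = 0` counts `O(R)` zeros, whence
absolute convergence for `p ≥ 2`. -/

theorem differentiable_deriv_of_differentiable {f : ℂ → ℂ} (hf : Differentiable ℂ f) :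
    Differentiable ℂ (deriv f) := by
  rw [← differentiableOn_univ] at hf ⊢
  exact hf.deriv isOpen_univ

/-! ### Formal Taylor series -/

/-- The formal Taylor series of `f` at `c`. -/
noncomputable def formalTaylor (c : ℂ) (f : ℂ → ℂ) : PowerSeries ℂ :=
  PowerSeries.mk fun n => iteratedDeriv n f c / (n.factorial : ℂ)

theorem coeff_formalTaylor (c : ℂ) (f : ℂ → ℂ) (n : ℕ) :
    PowerSeries.coeff n (formalTaylor c f) = iteratedDeriv n f c / (n.factorial : ℂ) :=
  PowerSeries.coeff_mk _ _

theorem formalTaylor_congr {c : ℂ} {f g : ℂ → ℂ} (h : f =ᶠ[nhds c] g) :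
    formalTaylor c f = formalTaylor c g := by
  ext n
  rw [coeff_formalTaylor, coeff_formalTaylor, h.iteratedDeriv_eq]

theorem formalTaylor_deriv (c : ℂ) (f : ℂ → ℂ) :
    formalTaylor c (deriv f) = PowerSeries.derivative ℂ (formalTaylor c f) := by
  ext n
  rw [PowerSeries.coeff_derivative, coeff_formalTaylor, coeff_formalTaylor, ← iteratedDeriv_succ',
    Nat.factorial_succ]
  have h1 : (n.factorial : ℂ) ≠ 0 := Nat.cast_ne_zero.mpr n.factorial_ne_zero
  have h2 : (n : ℂ) + 1 ≠ 0 := Nat.cast_add_one_ne_zero n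
  push_cast
  field_simp

theorem formalTaylor_add {c : ℂ} {f g : ℂ → ℂ} (hf : AnalyticAt ℂ f c) (hg : AnalyticAt ℂ g c) :
    formalTaylor c (fun z => f z + g z) = formalTaylor c f + formalTaylor c g := by
  ext n
  rw [map_add, coeff_formalTaylor, coeff_formalTaylor, coeff_formalTaylor,
    show (fun z => f z + g z) = f + g from rfl, iteratedDeriv_add hf.contDiffAt hg.contDiffAt,
    add_div]

theorem formalTaylor_mul {c : ℂ} {f g : ℂ → ℂ} (hf : AnalyticAt ℂ f c) (hg : AnalyticAt ℂ g c) :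
    formalTaylor c (fun z => f z * g z) = formalTaylor c f * formalTaylor c g := by
  ext n
  rw [PowerSeries.coeff_mul, coeff_formalTaylor, show (fun z => f z * g z) = f * g from rfl,
    iteratedDeriv_mul hf.contDiffAt hg.contDiffAt,
    Finset.Nat.sum_antidiagonal_eq_sum_range_succ_mk, Finset.sum_div]
  refine Finset.sum_congr rfl fun i hi => ?_
  have hi' : i ≤ n := Nat.lt_succ_iff.mp (Finset.mem_range.mp hi)
  simp only [coeff_formalTaylor]
  have h1 : (i.factorial : ℂ) ≠ 0 := Nat.cast_ne_zero.mpr i.factorial_ne_zero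
  have h2 : ((n - i).factorial : ℂ) ≠ 0 := Nat.cast_ne_zero.mpr (n - i).factorial_ne_zero
  have h3 : (n.factorial : ℂ) ≠ 0 := Nat.cast_ne_zero.mpr n.factorial_ne_zero
  have h4 : (n.choose i : ℂ) * i.factorial * (n - i).factorial = n.factorial := by
    exact_mod_cast Nat.choose_mul_factorial_mul_factorial hi'
  field_simp
  linear_combination (iteratedDeriv i f c * iteratedDeriv (n - i) g c) * h4

theorem formalTaylor_const (c k : ℂ) : formalTaylor c (fun _ => k) = PowerSeries.C k := by
  ext n
  rw [coeff_formalTaylor, iteratedDeriv_const, PowerSeries.coeff_C]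
  split_ifs with h <;> simp [h]

theorem formalTaylor_id (c : ℂ) :
    formalTaylor c (fun z => z) = PowerSeries.C c + PowerSeries.X := by
  ext n
  rw [coeff_formalTaylor, iteratedDeriv_fun_id, map_add, PowerSeries.coeff_C, PowerSeries.coeff_X]
  rcases n with _ | _ | n <;> simp

theorem formalTaylor_prod {ι : Type*} {c : ℂ} (s : Finset ι) {f : ι → ℂ → ℂ}
    (hf : ∀ i ∈ s, AnalyticAt ℂ (f i) c) :
    formalTaylor c (fun z => ∏ i ∈ s, f i z) = ∏ i ∈ s, formalTaylor c (f i) := by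
  classical
  induction s using Finset.induction_on with
  | empty => simpa using formalTaylor_const c 1
  | insert i s hi ih =>
    have h : ∀ j ∈ s, AnalyticAt ℂ (f j) c := fun j hj => hf j (Finset.mem_insert_of_mem hj)
    simp only [Finset.prod_insert hi]
    rw [formalTaylor_mul (hf i (Finset.mem_insert_self i s))
      (Finset.analyticAt_fun_prod s h), ih h]

theorem eq_zero_of_formalTaylor_eq_zero {c : ℂ} {f : ℂ → ℂ} (hf : Differentiable ℂ f)
    (h : formalTaylor c f = 0) (z : ℂ) : f z = 0 := by
  rw [← Complex.taylorSeries_eq_of_entire' c z hf]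
  have h0 : ∀ n, iteratedDeriv n f c = 0 := fun n => by
    have h1 := coeff_formalTaylor c f n
    rw [h, map_zero, eq_comm, div_eq_zero_iff] at h1
    exact h1.resolve_right (Nat.cast_ne_zero.mpr n.factorial_ne_zero)
  simp [h0]

/-! ### Zeros of entire functions of exponential type -/

/-- If `G' = V G` and `F = G ∏ (1 - X / s)`, then `F' = (V - ∑ ∑ₙ s^{-(n+1)} Xⁿ) F`. -/
theorem derivative_mul_prod_one_sub {G V : PowerSeries ℂ}
    (hG : PowerSeries.derivative ℂ G = V * G) (S : Finset ℂ) :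
    PowerSeries.derivative ℂ (G * ∏ s ∈ S, (1 - PowerSeries.C s⁻¹ * PowerSeries.X)) =
      (V - ∑ s ∈ S, PowerSeries.mk fun n => s⁻¹ ^ (n + 1)) *
        (G * ∏ s ∈ S, (1 - PowerSeries.C s⁻¹ * PowerSeries.X)) := by
  induction S using Finset.induction_on with
  | empty => simpa using hG
  | insert s S hs ih =>
    have key : PowerSeries.derivative ℂ (1 - PowerSeries.C s⁻¹ * PowerSeries.X) =
        -(PowerSeries.mk fun n => s⁻¹ ^ (n + 1)) * (1 - PowerSeries.C s⁻¹ * PowerSeries.X) := by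
      have hD : PowerSeries.derivative ℂ (1 - PowerSeries.C s⁻¹ * PowerSeries.X) =
          -PowerSeries.C s⁻¹ := by
        ext n
        rw [PowerSeries.coeff_derivative]
        rcases n with _ | n <;> simp [PowerSeries.coeff_one, PowerSeries.coeff_C]
      rw [hD, neg_mul, neg_inj, mul_sub, mul_one, mul_left_comm]
      ext n
      rcases n with _ | n
      · simp
      · rw [map_sub, PowerSeries.coeff_C_mul, PowerSeries.coeff_succ_mul_X]
        simp
        ring
    rw [Finset.prod_insert hs, Finset.sum_insert hs, mul_left_comm, Derivation.leibniz, ih, key]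
    simp only [smul_eq_mul]
    ring

/-- An entire function is divisible by `∏ (1 - z / s)`, for `s` over finitely many of its zeros. -/
theorem Differentiable.exists_eq_mul_prod_one_sub {f : ℂ → ℂ} (hf : Differentiable ℂ f)
    (S : Finset ℂ) (hS : ∀ s ∈ S, f s = 0 ∧ s ≠ 0) :
    ∃ g : ℂ → ℂ, Differentiable ℂ g ∧ ∀ z, f z = g z * ∏ s ∈ S, (1 - z / s) := by
  induction S using Finset.induction_on with
  | empty => exact ⟨f, hf, by simp⟩
  | insert s S hs ih =>
    obtain ⟨g, hg, hfg⟩ := ih fun t ht => hS t (Finset.mem_insert_of_mem ht)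
    obtain ⟨hfs, hs0⟩ := hS s (Finset.mem_insert_self s S)
    have hgs : g s = 0 := by
      rw [hfg s, mul_eq_zero] at hfs
      refine hfs.resolve_right (Finset.prod_ne_zero_iff.mpr fun t ht h => ?_)
      have ht0 := (hS t (Finset.mem_insert_of_mem ht)).2
      rw [sub_eq_zero, eq_div_iff ht0, one_mul] at h
      exact hs (h ▸ ht)
    -- Since `g s = 0`, `g z = (z - s) * dslope g s z`, and `z - s = -s (1 - z / s)`.
    refine ⟨fun z => -s * dslope g s z, ?_, fun z => ?_⟩
    · refine Differentiable.const_mul ?_ _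
      rw [← differentiableOn_univ] at hg ⊢
      exact (Complex.differentiableOn_dslope Filter.univ_mem).mpr hg
    · have h := sub_smul_dslope g s z
      rw [hgs, sub_zero, smul_eq_mul] at h
      rw [Finset.prod_insert hs, hfg z, ← h]
      field_simp
      ring

/-- The maximum principle for the quotient of `f` by `∏ (1 - z / s)`. -/
theorem norm_le_of_eq_mul_prod_one_sub {f g : ℂ → ℂ} {C R : ℝ} {S : Finset ℂ} (hR : 0 < R)
    (hC : ∀ z, ‖f z‖ ≤ Real.exp (C * ‖z‖)) (hg : Differentiable ℂ g)
    (hS : ∀ s ∈ S, s ≠ 0 ∧ ‖s‖ ≤ R) (hfg : ∀ z, f z = g z * ∏ s ∈ S, (1 - z / s))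
    {z : ℂ} (hz : ‖z‖ ≤ 3 * R) : ‖g z‖ * 2 ^ S.card ≤ Real.exp (C * (3 * R)) := by
  have hpos : (0 : ℝ) < 2 ^ S.card := by positivity
  rw [← le_div_iff₀ hpos]
  have hcl : closure (Metric.ball (0 : ℂ) (3 * R)) = Metric.closedBall 0 (3 * R) :=
    closure_ball _ (by positivity)
  refine Complex.norm_le_of_forall_mem_frontier_norm_le (U := Metric.ball (0 : ℂ) (3 * R))
    Metric.isBounded_ball hg.diffContOnCl ?_ (by rw [hcl]; simpa using hz)
  intro y hy
  rw [frontier_ball _ (by positivity), mem_sphere_zero_iff_norm] at hy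
  rw [le_div_iff₀ hpos]
  -- The radius `3 * R` makes `|y / s| ≥ 3`, so each factor has modulus at least `2`.
  have h2 : (2 : ℝ) ^ S.card ≤ ‖∏ s ∈ S, (1 - y / s)‖ := by
    rw [norm_prod, ← Finset.prod_const]
    refine Finset.prod_le_prod (fun _ _ => zero_le_two) fun s hs => ?_
    obtain ⟨hs0, hsR⟩ := hS s hs
    have h3 : 3 ≤ ‖y / s‖ := by
      rw [norm_div, hy, le_div_iff₀ (norm_pos_iff.mpr hs0)]
      linarith
    have h4 := norm_sub_norm_le (y / s) 1
    rw [norm_one, norm_sub_rev] at h4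
    linarith
  calc ‖g y‖ * 2 ^ S.card ≤ ‖g y‖ * ‖∏ s ∈ S, (1 - y / s)‖ := by gcongr
    _ = ‖f y‖ := by rw [hfg y, norm_mul]
    _ ≤ _ := by rw [← hy]; exact hC y

/-- Zeros of a function of exponential type in a disc of radius `R` number `O(R)`. -/
theorem card_zeros_le {f : ℂ → ℂ} (hf : Differentiable ℂ f) (hf0 : f 0 = 1) {C R : ℝ}
    (hR : 0 < R) (hC : ∀ z, ‖f z‖ ≤ Real.exp (C * ‖z‖)) (S : Finset ℂ)
    (hS : ∀ s ∈ S, f s = 0 ∧ ‖s‖ ≤ R) : (S.card : ℝ) ≤ 3 * C / Real.log 2 * R := by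
  have hS0 : ∀ s ∈ S, s ≠ 0 := by
    rintro s hs rfl
    simpa [hf0] using (hS 0 hs).1
  obtain ⟨g, hg, hfg⟩ := hf.exists_eq_mul_prod_one_sub S fun s hs => ⟨(hS s hs).1, hS0 s hs⟩
  have hg0 : g 0 = 1 := by simpa [hf0] using (hfg 0).symm
  have h := norm_le_of_eq_mul_prod_one_sub hR hC hg (fun s hs => ⟨hS0 s hs, (hS s hs).2⟩) hfg
    (z := 0) (by simp; positivity)
  rw [hg0, norm_one, one_mul] at h
  have h2 := Real.log_le_log (by positivity) h
  rw [Real.log_pow, Real.log_exp] at h2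
  rw [div_mul_eq_mul_div, le_div_iff₀ (Real.log_pos one_lt_two)]
  linarith

theorem finite_zeros_norm_le {f : ℂ → ℂ} (hf : Differentiable ℂ f) (hf0 : f 0 = 1) {C : ℝ}
    (hC : ∀ z, ‖f z‖ ≤ Real.exp (C * ‖z‖)) (R : ℝ) : {z | f z = 0 ∧ ‖z‖ ≤ R}.Finite := by
  -- `R` may be nonpositive, while the counting bound needs a positive radius.
  have hR : 0 < max R 1 := lt_max_of_lt_right one_pos
  by_contra hinf
  obtain ⟨n, hn⟩ := exists_nat_gt (3 * C / Real.log 2 * max R 1)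
  obtain ⟨S, hS, hcard⟩ := Set.Infinite.exists_subset_card_eq hinf n
  have h := card_zeros_le hf hf0 hR hC S
    fun s hs => ⟨(hS hs).1, (hS hs).2.trans (le_max_left R 1)⟩
  rw [hcard] at h
  linarith

/-- The counting bound, applied at the largest modulus in an `n`-element set, makes that modulus at
least `n / K`. Removing a largest element at each step replaces sorting the zeros. -/
theorem sum_norm_inv_pow_le {S : Finset ℂ} {K : ℝ} (p : ℕ) (h0 : ∀ s ∈ S, s ≠ 0)
    (hK : ∀ T ⊆ S, ∀ R, 0 < R → (∀ s ∈ T, ‖s‖ ≤ R) → (T.card : ℝ) ≤ K * R) :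
    ∑ s ∈ S, (‖s‖⁻¹) ^ p ≤ ∑ k ∈ Finset.range S.card, (K / ((k : ℝ) + 1)) ^ p := by
  induction hn : S.card generalizing S with
  | zero => simp [Finset.card_eq_zero.mp hn]
  | succ n ih =>
    have hne : S.Nonempty := Finset.card_pos.mp (by omega)
    obtain ⟨m, hm, hmax⟩ := S.exists_max_image (fun s => ‖s‖) hne
    have hmpos : 0 < ‖m‖ := norm_pos_iff.mpr (h0 m hm)
    rw [← Finset.sum_erase_add S _ hm, Finset.sum_range_succ]
    refine add_le_add (ih (fun s hs => h0 s (Finset.mem_of_mem_erase hs))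
      (fun T hT => hK T (hT.trans (Finset.erase_subset m S)))
      (by rw [Finset.card_erase_of_mem hm]; omega)) ?_
    have h := hK S subset_rfl ‖m‖ hmpos hmax
    rw [hn] at h
    push_cast at h
    have hn1 : (0 : ℝ) < n + 1 := by positivity
    gcongr
    rw [le_div_iff₀ hn1, inv_mul_le_iff₀ hmpos]
    linarith

theorem summable_norm_zpow_zeros {f : ℂ → ℂ} (hf : Differentiable ℂ f) (hf0 : f 0 = 1) {C : ℝ}
    (hC0 : 0 < C) (hC : ∀ z, ‖f z‖ ≤ Real.exp (C * ‖z‖)) {p : ℕ} (hp : 2 ≤ p) :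
    Summable fun z : {z | f z = 0} => ‖(z : ℂ) ^ (-(p : ℤ))‖ := by
  set K := 3 * C / Real.log 2
  have hK0 : 0 ≤ K := div_nonneg (by positivity) (Real.log_nonneg one_le_two)
  have hs : Summable fun k : ℕ => (K / ((k : ℝ) + 1)) ^ p := by
    have h1 : Summable fun k : ℕ => 1 / ((k : ℝ) ^ p) :=
      Real.summable_one_div_nat_pow.mpr (by omega)
    have h2 := ((summable_nat_add_iff 1).mpr h1).mul_left (K ^ p)
    refine h2.congr fun k => ?_
    push_cast
    rw [div_pow]
    ring
  refine summable_of_sum_le (c := ∑' k : ℕ, (K / ((k : ℝ) + 1)) ^ p)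
    (fun z => norm_nonneg _) fun u => ?_
  have hmem : ∀ s ∈ u.map (Function.Embedding.subtype _), f s = 0 := by
    intro s hs
    obtain ⟨t, -, rfl⟩ := Finset.mem_map.mp hs
    exact t.2
  have h := sum_norm_inv_pow_le (S := u.map (Function.Embedding.subtype _)) (K := K) p
    (fun s hs h => by simpa [h, hf0] using hmem s hs)
    (fun T hT R hR hTR => card_zeros_le hf hf0 hR hC T fun s hs => ⟨hmem s (hT hs), hTR s hs⟩)
  rw [Finset.sum_map] at h
  refine le_trans (le_of_eq (Finset.sum_congr rfl fun z _ => ?_))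
    (h.trans (hs.sum_le_tsum _ fun k _ => by positivity))
  simp

/-! ### Logarithmic derivative and power sums of inverse zeros -/

/-- A zero-free function bounded on a disc has a logarithm with small Taylor coefficients. -/
theorem exists_log_derivative_coeff_le {g : ℂ → ℂ} (hg : Differentiable ℂ g) (hg0 : g 0 = 1)
    {M R : ℝ} (hR : 0 < R) (hM : 0 < M) (hne : ∀ z ∈ Metric.ball (0 : ℂ) R, g z ≠ 0)
    (hgM : ∀ z ∈ Metric.ball (0 : ℂ) R, ‖g z‖ ≤ Real.exp M) :
    ∃ V : PowerSeries ℂ, PowerSeries.derivative ℂ (formalTaylor 0 g) = V * formalTaylor 0 g ∧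
      ∀ n : ℕ, ‖PowerSeries.coeff n V‖ ≤ (n + 1) * (2 * M / (R / 2) ^ (n + 1)) := by
  have hg' := differentiable_deriv_of_differentiable hg
  have hq : DifferentiableOn ℂ (fun z => deriv g z / g z) (Metric.ball 0 R) :=
    hg'.differentiableOn.div hg.differentiableOn hne
  -- `H` is the primitive of `g'/g` with `H 0 = 0`; as `g * exp (-H)` has zero derivative, `H` is a
  -- logarithm of `g`.
  obtain ⟨H, hH0, hH⟩ := hq.isExactOn_ball.with_val_at 0 0
  have hHd : DifferentiableOn ℂ H (Metric.ball 0 R) :=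
    fun z hz => (hH z hz).differentiableAt.differentiableWithinAt
  have hexp : ∀ z ∈ Metric.ball (0 : ℂ) R, g z = Complex.exp (H z) := by
    intro z hz
    have hd : ∀ y ∈ Metric.ball (0 : ℂ) R,
        HasDerivAt (fun y => g y * Complex.exp (-H y)) 0 y := by
      intro y hy
      refine ((hg y).hasDerivAt.mul (hH y hy).neg.cexp).congr_deriv ?_
      have := hne y hy
      simp only [Pi.neg_apply]
      field_simp
      ring
    have hconst := (convex_ball (0 : ℂ) R).is_const_of_fderivWithin_eq_zero (𝕜 := ℂ)
      (f := fun y => g y * Complex.exp (-H y))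
      (fun y hy => (hd y hy).differentiableAt.differentiableWithinAt)
      (fun y hy => by
        rw [fderivWithin_of_isOpen Metric.isOpen_ball hy, (hd y hy).hasFDerivAt.fderiv]
        ext
        simp) hz (Metric.mem_ball_self hR)
    simp only [hg0, hH0, neg_zero, Complex.exp_zero, mul_one, Complex.exp_neg] at hconst
    rwa [mul_inv_eq_one₀ (Complex.exp_ne_zero _)] at hconst
  have hre : Set.MapsTo H (Metric.ball 0 R) {z | z.re ≤ M} := by
    intro z hz
    have h := hgM z hz
    rw [hexp z hz, Complex.norm_exp, Real.exp_le_exp] at h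
    exact h
  have hR2 : 0 < R / 2 := by positivity
  have hcoeff : ∀ n : ℕ, ‖iteratedDeriv n H 0‖ ≤ n.factorial * (2 * M) / (R / 2) ^ n := by
    intro n
    refine Complex.norm_iteratedDeriv_le_of_forall_mem_sphere_norm_le n hR2 ?_ ?_
    · refine DifferentiableOn.diffContOnCl (hHd.mono ?_)
      rw [closure_ball _ hR2.ne']
      exact Metric.closedBall_subset_ball (by linarith)
    · intro z hz
      rw [mem_sphere_zero_iff_norm] at hz
      -- At `|z| = R / 2` the bound `2M|z| / (R - |z|)` equals `2M`.
      have h := Complex.borelCaratheodory_zero hM hHd hre hR (z := z)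
        (by rw [mem_ball_zero_iff]; linarith) hH0
      rw [hz] at h
      convert h using 1
      field_simp
      ring
  have hA : ∀ {h : ℂ → ℂ}, DifferentiableOn ℂ h (Metric.ball 0 R) → AnalyticAt ℂ h 0 :=
    fun h => h.analyticAt (Metric.ball_mem_nhds 0 hR)
  refine ⟨formalTaylor 0 (deriv H), ?_, fun n => ?_⟩
  · rw [← formalTaylor_deriv, ← formalTaylor_mul (hA (hHd.deriv Metric.isOpen_ball))
      (hA hg.differentiableOn)]
    refine formalTaylor_congr ?_
    filter_upwards [Metric.ball_mem_nhds (0 : ℂ) hR] with z hz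
    rw [(hH z hz).deriv, div_mul_cancel₀ _ (hne z hz)]
  · rw [coeff_formalTaylor, ← iteratedDeriv_succ', norm_div, Complex.norm_natCast,
      div_le_iff₀ (by positivity)]
    refine (hcoeff (n + 1)).trans (le_of_eq ?_)
    rw [Nat.factorial_succ]
    push_cast
    ring

theorem norm_coeff_add_sum_zeros_le {f : ℂ → ℂ} (hf : Differentiable ℂ f) (hf0 : f 0 = 1)
    (hsimple : ∀ z, f z = 0 → deriv f z ≠ 0) {C R : ℝ} (hC0 : 0 < C) (hR : 0 < R)
    (hC : ∀ z, ‖f z‖ ≤ Real.exp (C * ‖z‖)) {S : Finset ℂ}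
    (hS : ∀ s, s ∈ S ↔ f s = 0 ∧ ‖s‖ ≤ R) {U : PowerSeries ℂ}
    (hU : PowerSeries.derivative ℂ (formalTaylor 0 f) = U * formalTaylor 0 f) (n : ℕ) :
    ‖PowerSeries.coeff n U + ∑ s ∈ S, s⁻¹ ^ (n + 1)‖ ≤
      (n + 1) * (2 * (C * (3 * R)) / (R / 2) ^ (n + 1)) := by
  have hS0 : ∀ s ∈ S, s ≠ 0 := by
    rintro s hs rfl
    simpa [hf0] using ((hS 0).mp hs).1
  obtain ⟨g, hg, hfg⟩ := hf.exists_eq_mul_prod_one_sub S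
    fun s hs => ⟨((hS s).mp hs).1, hS0 s hs⟩
  have hg0 : g 0 = 1 := by simpa [hf0] using (hfg 0).symm
  have hP : Differentiable ℂ fun z : ℂ => ∏ s ∈ S, (1 - z / s) :=
    Differentiable.fun_finsetProd fun s _ => by fun_prop
  -- A zero of `g` here would also be a zero of the product, hence a multiple zero of `f`.
  have hne : ∀ z ∈ Metric.ball (0 : ℂ) R, g z ≠ 0 := by
    intro z hz hgz
    have hfz : f z = 0 := by rw [hfg z, hgz, zero_mul]
    have hzS : z ∈ S := (hS z).mpr ⟨hfz, (mem_ball_zero_iff.mp hz).le⟩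
    refine hsimple z hfz ?_
    rw [show f = fun z => g z * ∏ s ∈ S, (1 - z / s) from funext hfg,
      deriv_fun_mul (hg z) (hP z), hgz, zero_mul, add_zero,
      Finset.prod_eq_zero hzS (by rw [div_self (hS0 z hzS), sub_self]), mul_zero]
  obtain ⟨V, hV, hVn⟩ := exists_log_derivative_coeff_le hg hg0 hR
    (M := C * (3 * R)) (by positivity) hne fun z hz => by
      refine le_trans ?_ (norm_le_of_eq_mul_prod_one_sub hR hC hg
        (fun s hs => ⟨hS0 s hs, ((hS s).mp hs).2⟩) hfg (z := z)
        (by have := mem_ball_zero_iff.mp hz; linarith))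
      exact le_mul_of_one_le_right (norm_nonneg _) (one_le_pow₀ one_le_two)
  have hT : formalTaylor 0 f =
      formalTaylor 0 g * ∏ s ∈ S, (1 - PowerSeries.C s⁻¹ * PowerSeries.X) := by
    have hfac : ∀ s : ℂ, formalTaylor 0 (fun z => 1 - z / s) =
        1 - PowerSeries.C s⁻¹ * PowerSeries.X := by
      intro s
      have h1 : (fun z : ℂ => 1 - z / s) = fun z => (fun _ => (1 : ℂ)) z +
          (fun z => (fun _ => -s⁻¹) z * (fun z => z) z) z := by
        funext z
        simp only
        ring
      rw [h1, formalTaylor_add (by fun_prop) (by fun_prop),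
        formalTaylor_mul (by fun_prop) (by fun_prop), formalTaylor_const, formalTaylor_const,
        formalTaylor_id]
      simp
      ring
    rw [show f = fun z => g z * ∏ s ∈ S, (1 - z / s) from funext hfg,
      formalTaylor_mul (hg.analyticAt 0) (hP.analyticAt 0),
      formalTaylor_prod S fun s _ => by fun_prop]
    simp only [hfac]
  have hT0 : formalTaylor 0 f ≠ 0 := fun h => by
    simpa [hf0] using eq_zero_of_formalTaylor_eq_zero hf h 0
  -- Cancelling the nonzero series of `f` leaves `U = V - ∑ ∑ₙ s^{-(n+1)} Xⁿ`, so the quantity to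
  -- bound is a coefficient of `V`.
  have hd := derivative_mul_prod_one_sub hV S
  rw [← hT, hU] at hd
  rw [mul_right_cancel₀ hT0 hd]
  simpa using hVn n

/-- The Taylor coefficients of `f' / f` at `0` are, up to sign, the power sums of the inverses
of the zeros, if `f` is of exponential type. -/
theorem tsum_zpow_zeros_eq_neg_coeff {f : ℂ → ℂ} (hf : Differentiable ℂ f) (hf0 : f 0 = 1)
    (hsimple : ∀ z, f z = 0 → deriv f z ≠ 0) {C : ℝ} (hC0 : 0 < C)
    (hC : ∀ z, ‖f z‖ ≤ Real.exp (C * ‖z‖)) {U : PowerSeries ℂ}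
    (hU : PowerSeries.derivative ℂ (formalTaylor 0 f) = U * formalTaylor 0 f) {n : ℕ}
    (hn : 1 ≤ n) :
    ∑' z : {z | f z = 0}, (z : ℂ) ^ (-((n + 1 : ℕ) : ℤ)) = -PowerSeries.coeff n U := by
  have hsum := (summable_norm_zpow_zeros hf hf0 hC0 hC (p := n + 1) (by omega)).of_norm.hasSum
  have hfin := fun N : ℕ => finite_zeros_norm_le hf hf0 hC (N : ℝ)
  -- The zeros in the disc of radius `N` exhaust all zeros, so by summability their partial sums
  -- tend to the full sum.
  let A : ℕ → Finset {z | f z = 0} := fun N => (hfin N).toFinset.subtype _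
  have hA : Filter.Tendsto A Filter.atTop Filter.atTop := by
    refine Filter.tendsto_atTop_finset_of_monotone ?_ ?_
    · intro N M hNM z hz
      simp only [A, Finset.mem_subtype, Set.Finite.mem_toFinset] at hz ⊢
      exact ⟨hz.1, hz.2.trans (Nat.cast_le.mpr hNM)⟩
    · intro z
      obtain ⟨N, hN⟩ := exists_nat_ge ‖(z : ℂ)‖
      refine ⟨N, ?_⟩
      simp only [A, Finset.mem_subtype, Set.Finite.mem_toFinset]
      exact ⟨z.2, hN⟩
  have hlim := hsum.comp hA
  refine tendsto_nhds_unique hlim ?_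
  rw [tendsto_iff_norm_sub_tendsto_zero]
  have hbound : Filter.Tendsto
      (fun N : ℕ => (n + 1) * (2 * (C * (3 * (N : ℝ))) / ((N : ℝ) / 2) ^ (n + 1)))
      Filter.atTop (nhds 0) := by
    have h1 : Filter.Tendsto (fun N : ℕ => ((n + 1) * (6 * C) * 2 ^ (n + 1)) * ((N : ℝ)⁻¹) ^ n)
        Filter.atTop (nhds 0) := by
      have h2 := ((tendsto_inv_atTop_nhds_zero_nat (𝕜 := ℝ)).pow n).const_mul
        ((n + 1) * (6 * C) * 2 ^ (n + 1))
      rwa [zero_pow (by omega), mul_zero] at h2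
    refine h1.congr' ?_
    filter_upwards [Filter.eventually_gt_atTop 0] with N hN
    have : (N : ℝ) ≠ 0 := by positivity
    rw [inv_pow, div_pow]
    field_simp
    ring
  refine squeeze_zero' (Filter.Eventually.of_forall fun N => norm_nonneg _) ?_ hbound
  filter_upwards [Filter.eventually_gt_atTop 0] with N hN
  have h := norm_coeff_add_sum_zeros_le hf hf0 hsimple hC0 (R := N) (by positivity) hC
    (S := (hfin N).toFinset) (fun s => by simp) hU n
  refine le_trans (le_of_eq ?_) h
  rw [sub_neg_eq_add, add_comm]
  congr 2
  simp only [Function.comp, A]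
  rw [Finset.sum_subtype_of_mem (fun z : ℂ => z ^ (-((n + 1 : ℕ) : ℤ)))
    (fun z hz => ((Set.Finite.mem_toFinset _).mp hz).1)]
  refine Finset.sum_congr rfl fun s _ => ?_
  rw [zpow_neg, zpow_natCast, inv_pow]

/-! ### Kummer's function: growth, differential equation, Riccati recursion -/

/-- The Taylor coefficients of `₁F₁(a; b; ·)`. -/
noncomputable def kummerCoeff (a b : ℂ) (n : ℕ) : ℂ :=
  (ascPochhammer ℂ n).eval a / (ascPochhammer ℂ n).eval b / (n.factorial : ℂ)

section

variable {a b : ℂ}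

theorem add_natCast_ne_zero (hb : ∀ n : ℕ, b ≠ -(n : ℂ)) (n : ℕ) : b + n ≠ 0 :=
  fun h => hb n (eq_neg_of_add_eq_zero_left h)

theorem ascPochhammer_eval_ne_zero (hb : ∀ n : ℕ, b ≠ -(n : ℂ)) (n : ℕ) :
    (ascPochhammer ℂ n).eval b ≠ 0 := by
  induction n with
  | zero => simp
  | succ n ih =>
    rw [ascPochhammer_succ_eval]
    exact mul_ne_zero ih (add_natCast_ne_zero hb n)

theorem kummerCoeff_zero : kummerCoeff a b 0 = 1 := by simp [kummerCoeff]

theorem kummerCoeff_succ (hb : ∀ n : ℕ, b ≠ -(n : ℂ)) (n : ℕ) :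
    ((n : ℂ) + 1) * (b + n) * kummerCoeff a b (n + 1) = (a + n) * kummerCoeff a b n := by
  have h1 := ascPochhammer_eval_ne_zero hb n
  have h2 := add_natCast_ne_zero hb n
  have h3 : (n.factorial : ℂ) ≠ 0 := Nat.cast_ne_zero.mpr n.factorial_ne_zero
  have h4 : (n : ℂ) + 1 ≠ 0 := Nat.cast_add_one_ne_zero n
  rw [kummerCoeff, kummerCoeff, ascPochhammer_succ_eval, ascPochhammer_succ_eval,
    Nat.factorial_succ]
  push_cast
  field_simp

/-- Consecutive coefficients have ratio `(a + n) / (b + n) / (n + 1)`, and `(a + n) / (b + n)`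
converges, hence is bounded. This is the source of exponential type. -/
theorem exists_norm_kummerCoeff_le (hb : ∀ n : ℕ, b ≠ -(n : ℂ)) :
    ∃ C : ℝ, 0 < C ∧ ∀ n, ‖kummerCoeff a b n‖ ≤ C ^ n / n.factorial := by
  have hlim : Filter.Tendsto (fun n : ℕ => (a + n) / (b + n)) Filter.atTop (nhds 1) := by
    have h1 : ∀ c : ℂ, Filter.Tendsto (fun n : ℕ => c / n + 1) Filter.atTop (nhds 1) := fun c => by
      simpa using (tendsto_const_div_atTop_nhds_zero_nat c).add_const 1
    have h2 := (h1 a).div (h1 b) one_ne_zero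
    rw [div_one] at h2
    refine h2.congr' ?_
    filter_upwards [Filter.eventually_ne_atTop 0] with n hn
    have hn' : (n : ℂ) ≠ 0 := Nat.cast_ne_zero.mpr hn
    have h3 := add_natCast_ne_zero hb n
    have h4 : b / n + 1 ≠ 0 := by
      rw [div_add_one hn']
      exact div_ne_zero h3 hn'
    simp only [Pi.div_apply]
    rw [div_add_one hn', div_add_one hn', div_div_div_cancel_right₀ hn']
  obtain ⟨C, hC⟩ := (Metric.isBounded_range_of_tendsto _ hlim).exists_norm_le
  have hC' : ∀ n : ℕ, ‖(a + n) / (b + n)‖ ≤ C + 1 := fun n =>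
    (hC _ (Set.mem_range_self n)).trans (by linarith)
  have hC0 : 0 ≤ C := (norm_nonneg _).trans (hC _ (Set.mem_range_self 0))
  refine ⟨C + 1, by linarith, fun n => ?_⟩
  induction n with
  | zero => simp [kummerCoeff_zero]
  | succ n ih =>
    have h2 := add_natCast_ne_zero hb n
    have h4 : (n : ℂ) + 1 ≠ 0 := Nat.cast_add_one_ne_zero n
    have h5 : kummerCoeff a b (n + 1) =
        (a + n) / (b + n) * kummerCoeff a b n / ((n : ℂ) + 1) := by
      have := kummerCoeff_succ (a := a) hb n
      field_simp
      linear_combination this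
    have h6 : ‖(n : ℂ) + 1‖ = n + 1 := by
      rw [← Nat.cast_add_one, Complex.norm_natCast]
      push_cast
      rfl
    rw [h5, norm_div, norm_mul, h6, Nat.factorial_succ, pow_succ]
    calc ‖(a + n) / (b + n)‖ * ‖kummerCoeff a b n‖ / ((n : ℝ) + 1)
        ≤ (C + 1) * ((C + 1) ^ n / n.factorial) / ((n : ℝ) + 1) := by
          gcongr
          exact hC' n
      _ = _ := by
          push_cast
          field_simp

theorem kummerM_eq_tsum (z : ℂ) : kummerM a b z = ∑' n, kummerCoeff a b n * z ^ n := by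
  rw [kummerM]
  refine tsum_congr fun n => ?_
  rw [kummerCoeff]
  ring

theorem norm_kummerM_le {C : ℝ} (hC : ∀ n, ‖kummerCoeff a b n‖ ≤ C ^ n / n.factorial) (z : ℂ) :
    ‖kummerM a b z‖ ≤ Real.exp (C * ‖z‖) := by
  rw [kummerM_eq_tsum]
  have hexp : HasSum (fun n : ℕ => (C * ‖z‖) ^ n / n.factorial) (Real.exp (C * ‖z‖)) := by
    rw [Real.exp_eq_exp_ℝ]
    exact NormedSpace.expSeries_div_hasSum_exp (C * ‖z‖)
  refine tsum_of_norm_bounded hexp fun n => ?_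
  rw [norm_mul, norm_pow, mul_pow, mul_div_right_comm]
  gcongr
  exact hC n

theorem hasFPowerSeriesOnBall_kummerM (hb : ∀ n : ℕ, b ≠ -(n : ℂ)) :
    HasFPowerSeriesOnBall (kummerM a b)
      (FormalMultilinearSeries.ofScalars ℂ (kummerCoeff a b)) 0 ⊤ := by
  obtain ⟨C, hC0, hC⟩ := exists_norm_kummerCoeff_le (a := a) hb
  have hr : (FormalMultilinearSeries.ofScalars ℂ (kummerCoeff a b)).radius = ⊤ := by
    refine FormalMultilinearSeries.radius_eq_top_of_summable_norm _ fun r => ?_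
    refine Summable.of_nonneg_of_le (fun n => by positivity) (fun n => ?_)
      (Real.summable_pow_div_factorial (C * r))
    rw [FormalMultilinearSeries.ofScalars_norm, mul_pow, mul_div_right_comm]
    gcongr
    exact hC n
  have h := FormalMultilinearSeries.hasFPowerSeriesOnBall
    (FormalMultilinearSeries.ofScalars ℂ (kummerCoeff a b)) (by rw [hr]; exact ENNReal.zero_lt_top)
  rw [hr] at h
  refine h.congr fun z _ => ?_
  rw [kummerM_eq_tsum, FormalMultilinearSeries.sum]
  refine tsum_congr fun n => ?_
  rw [FormalMultilinearSeries.ofScalars_apply_eq, smul_eq_mul]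

theorem differentiable_kummerM (hb : ∀ n : ℕ, b ≠ -(n : ℂ)) : Differentiable ℂ (kummerM a b) := by
  have h := (hasFPowerSeriesOnBall_kummerM (a := a) hb).differentiableOn
  rwa [Metric.eball_top, differentiableOn_univ] at h

theorem formalTaylor_kummerM (hb : ∀ n : ℕ, b ≠ -(n : ℂ)) :
    formalTaylor 0 (kummerM a b) = PowerSeries.mk (kummerCoeff a b) := by
  have h1 := (hasFPowerSeriesOnBall_kummerM (a := a) hb).hasFPowerSeriesAt
  have h2 := h1.eq_formalMultilinearSeries
    ((differentiable_kummerM (a := a) hb).analyticAt 0).hasFPowerSeriesAt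
  rw [FormalMultilinearSeries.ofScalars_series_eq_iff] at h2
  ext n
  rw [coeff_formalTaylor, PowerSeries.coeff_mk, h2]

theorem kummerM_zero (hb : ∀ n : ℕ, b ≠ -(n : ℂ)) : kummerM a b 0 = 1 := by
  have h := congrArg (PowerSeries.coeff 0) (formalTaylor_kummerM (a := a) hb)
  simpa [coeff_formalTaylor, kummerCoeff_zero] using h

open PowerSeries in
/-- Kummer's equation for the Taylor series at the origin. -/
theorem formal_kummer_equation (hb : ∀ n : ℕ, b ≠ -(n : ℂ)) :
    X * derivative ℂ (derivative ℂ (formalTaylor 0 (kummerM a b))) +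
      (C b - X) * derivative ℂ (formalTaylor 0 (kummerM a b)) -
        C a * formalTaylor 0 (kummerM a b) = 0 := by
  rw [formalTaylor_kummerM hb]
  ext n
  have h := kummerCoeff_succ (a := a) hb n
  rcases n with _ | n
  · rw [sub_mul]
    simp only [map_sub, map_add, coeff_zero_X_mul, coeff_C_mul, coeff_derivative, coeff_mk, map_zero]
    push_cast at h ⊢
    linear_combination h
  · rw [sub_mul]
    simp only [map_sub, map_add, coeff_succ_X_mul, coeff_C_mul, coeff_derivative, coeff_mk, map_zero]
    push_cast at h ⊢
    linear_combination h

open PowerSeries in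
-- The variable `z` expands as `c + X`. The case `c = 0` transfers Kummer's equation from series to
-- functions; a zero `c` of `w` serves to prove simplicity.
theorem formalTaylor_kummer_operator (a b c : ℂ) {f : ℂ → ℂ} (hf : Differentiable ℂ f) :
    formalTaylor c (fun z => z * deriv (deriv f) z + (b + (-1) * z) * deriv f z + (-a) * f z) =
      (C c + X) * derivative ℂ (derivative ℂ (formalTaylor c f)) +
        (C b - (C c + X)) * derivative ℂ (formalTaylor c f) - C a * formalTaylor c f := by
  have h1 := differentiable_deriv_of_differentiable hf
  have h2 := differentiable_deriv_of_differentiable h1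
  have A0 := hf.analyticAt c
  have A1 := h1.analyticAt c
  have A2 := h2.analyticAt c
  rw [formalTaylor_add (f := fun z => z * deriv (deriv f) z + (b + (-1) * z) * deriv f z)
      (by fun_prop) (by fun_prop),
    formalTaylor_add (f := fun z => z * deriv (deriv f) z) (by fun_prop) (by fun_prop),
    formalTaylor_mul (f := fun z => z) (by fun_prop) A2,
    formalTaylor_mul (f := fun z => b + (-1) * z) (by fun_prop) A1,
    formalTaylor_add (f := fun z => b) (by fun_prop) (by fun_prop),
    formalTaylor_mul (f := fun _ => (-1 : ℂ)) (by fun_prop) (by fun_prop),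
    formalTaylor_mul (f := fun _ => -a) (by fun_prop) A0,
    formalTaylor_const, formalTaylor_const, formalTaylor_const, formalTaylor_id,
    formalTaylor_deriv, formalTaylor_deriv]
  simp only [map_neg, map_one]
  ring

/-- Kummer's differential equation. -/
theorem kummer_equation (hb : ∀ n : ℕ, b ≠ -(n : ℂ)) (z : ℂ) :
    z * deriv (deriv (kummerM a b)) z + (b + (-1) * z) * deriv (kummerM a b) z +
      (-a) * kummerM a b z = 0 := by
  have h0 := differentiable_kummerM (a := a) hb
  have h1 := differentiable_deriv_of_differentiable h0
  have h2 := differentiable_deriv_of_differentiable h1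
  refine eq_zero_of_formalTaylor_eq_zero (c := 0)
    (f := fun z => z * deriv (deriv (kummerM a b)) z + (b + (-1) * z) * deriv (kummerM a b) z +
      (-a) * kummerM a b z) (by fun_prop) ?_ z
  rw [formalTaylor_kummer_operator a b 0 h0, map_zero, zero_add]
  exact formal_kummer_equation hb

open PowerSeries in
-- Uniqueness for a second-order linear equation at a regular point: `w 0 = 1` gives `c ≠ 0`, so a
-- double zero at `c` would force every Taylor coefficient there to vanish.
theorem deriv_kummerM_ne_zero (hb : ∀ n : ℕ, b ≠ -(n : ℂ)) {c : ℂ} (hc : kummerM a b c = 0) :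
    deriv (kummerM a b) c ≠ 0 := by
  intro hc'
  have h0 := differentiable_kummerM (a := a) hb
  have hc0 : c ≠ 0 := by
    rintro rfl
    exact one_ne_zero ((kummerM_zero hb).symm.trans hc)
  have hode := formalTaylor_kummer_operator a b c h0
  rw [show (fun z => _) = fun _ : ℂ => (0 : ℂ) from funext (kummer_equation (a := a) hb),
    formalTaylor_const, map_zero] at hode
  set W := formalTaylor c (kummerM a b) with hW
  have hzero : ∀ n, coeff n W = 0 ∧ coeff (n + 1) W = 0 := by
    intro n
    induction n with
    | zero => simp [hW, coeff_formalTaylor, hc, hc']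
    | succ n ih =>
      refine ⟨ih.2, ?_⟩
      have h := congrArg (coeff n) hode
      have h4 : (n : ℂ) + 1 ≠ 0 := Nat.cast_add_one_ne_zero n
      have h5 : (n : ℂ) + 1 + 1 ≠ 0 := by exact_mod_cast Nat.cast_add_one_ne_zero (R := ℂ) (n + 1)
      -- In the coefficient of `X ^ n` of the equation, all other terms involve only coefficients
      -- `n` and `n + 1` of `W`, which vanish by induction.
      have h6 : c * (coeff (n + 1 + 1) W * ((n : ℂ) + 1 + 1) * ((n : ℂ) + 1)) = 0 := by
        rw [sub_mul, add_mul, add_mul] at h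
        obtain ⟨ih1, ih2⟩ := ih
        rcases n with _ | n
        · simp only [map_sub, map_add, coeff_zero_X_mul, coeff_C_mul, coeff_derivative, map_zero,
            ih1, ih2] at h
          push_cast at h ⊢
          linear_combination -h
        · simp only [map_sub, map_add, coeff_succ_X_mul, coeff_C_mul, coeff_derivative, map_zero,
            ih1, ih2] at h
          push_cast at h ⊢
          linear_combination -h
      simpa [hc0, h4, h5] using h6
  have hW0 : W = 0 := by
    ext n
    rw [(hzero n).1, map_zero]
  exact one_ne_zero ((kummerM_zero hb).symm.trans (eq_zero_of_formalTaylor_eq_zero h0 hW0 0))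

open PowerSeries in
/-- The Riccati recursion for the Taylor coefficients of the logarithmic derivative. -/
theorem exists_kummer_riccati (hb : ∀ n : ℕ, b ≠ -(n : ℂ)) :
    ∃ U : PowerSeries ℂ,
      derivative ℂ (formalTaylor 0 (kummerM a b)) = U * formalTaylor 0 (kummerM a b) ∧
      b * coeff 0 U = a ∧ ∀ n : ℕ, ((n : ℂ) + 1 + b) * coeff (n + 1) U =
        coeff n U - ∑ p ∈ Finset.HasAntidiagonal.antidiagonal n, coeff p.1 U * coeff p.2 U := by
  have hode := formal_kummer_equation (a := a) hb
  set W := formalTaylor 0 (kummerM a b) with hW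
  have hW0 : constantCoeff W ≠ 0 := by
    rw [← coeff_zero_eq_constantCoeff_apply, hW, coeff_formalTaylor]
    simp [kummerM_zero hb]
  have hWne : W ≠ 0 := fun h => hW0 (by rw [h, map_zero])
  have hU : derivative ℂ W = derivative ℂ W * W⁻¹ * W := by
    rw [mul_assoc, PowerSeries.inv_mul_cancel _ hW0, mul_one]
  refine ⟨derivative ℂ W * W⁻¹, hU, ?_⟩
  set U := derivative ℂ W * W⁻¹
  -- From `W' = U W` follows `W'' = (U' + U²) W`; then `W` cancels.
  have hR : X * (derivative ℂ U + U * U) + (C b - X) * U - C a = 0 := by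
    refine mul_right_cancel₀ hWne ?_
    rw [hU, Derivation.leibniz, hU, smul_eq_mul, smul_eq_mul] at hode
    rw [zero_mul, ← hode]
    ring
  constructor
  · have h := congrArg (coeff 0) hR
    rw [sub_mul] at h
    simp only [map_sub, map_add, coeff_zero_X_mul, coeff_C_mul, coeff_zero_C, map_zero] at h
    linear_combination h
  · intro n
    have h := congrArg (coeff (n + 1)) hR
    rw [sub_mul] at h
    simp only [map_sub, map_add, coeff_succ_X_mul, coeff_C_mul, coeff_derivative, map_zero] at h
    rw [coeff_mul n U U, coeff_C, if_neg n.succ_ne_zero] at h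
    linear_combination h

end

/-! ### From the Riccati recursion to the power sums -/

/-- The two end terms are isolated because they contain `U₀ = a / b`, which is not given by a power
sum; they produce the factor `b - 2a`. The shift `m = i + 1` matches `Uᵢ = -S_{i+1}`. -/
theorem sum_antidiagonal_eq_sum_Icc {M : Type*} [AddCommMonoid M] (g : ℕ → ℕ → M) (k : ℕ) :
    ∑ p ∈ Finset.HasAntidiagonal.antidiagonal (k + 2), g p.1 p.2 =
      g 0 (k + 2) + g (k + 2) 0 + ∑ m ∈ Finset.Icc 2 (k + 2), g (m - 1) (k + 3 - m) := by
  rw [Finset.Nat.sum_antidiagonal_eq_sum_range_succ g, Finset.sum_range_succ,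
    Finset.sum_range_succ']
  rw [Nat.sub_self, Nat.sub_zero, add_assoc, add_comm]
  congr 1
  rw [← Finset.Ico_add_one_right_eq_Icc, Finset.sum_Ico_eq_sum_range]
  refine Finset.sum_congr (by congr 1) fun i hi => ?_
  rw [Finset.mem_range] at hi
  congr 1 <;> omega

theorem mainTheorem4 (a b : ℂ) (hb : ∀ n : ℕ, b ≠ -(n : ℂ)) :
    -- all zeros are simple, so that summing over the set of zeros counts multiplicities
    (∀ z : ℂ, kummerM a b z = 0 → deriv (kummerM a b) z ≠ 0) ∧
    -- the series defining the sums converge (absolutely)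
    (∀ p : ℕ, 2 ≤ p → Summable (fun z : kummerZeros a b => ‖(z : ℂ) ^ (-(p : ℤ))‖)) ∧
    kummerS a b 2 = a * (a - b) / (b ^ 2 * (b + 1)) ∧
    kummerS a b 3 = a * (a - b) * (b - 2 * a) / (b ^ 3 * (b + 1) * (b + 2)) ∧
    (∀ k : ℕ, 3 ≤ k →
      kummerS a b (k + 1) =
        1 / (b * ((k : ℂ) + b)) *
          ((b - 2 * a) * kummerS a b k +
            b * ∑ m ∈ Finset.Icc 2 (k - 1), kummerS a b m * kummerS a b (k - m + 1))) ∧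
    kummerS a b 4 =
      a * (a - b) * (a * (a - b) * (5 * b + 6) + b ^ 2 * (b + 1)) /
        (b ^ 4 * (b + 1) ^ 2 * (b + 2) * (b + 3)) := by
  obtain ⟨C, hC0, hC⟩ := exists_norm_kummerCoeff_le (a := a) hb
  have hM := norm_kummerM_le hC
  have hd := differentiable_kummerM (a := a) hb
  have h0 := kummerM_zero (a := a) hb
  have hsimple : ∀ z : ℂ, kummerM a b z = 0 → deriv (kummerM a b) z ≠ 0 :=
    fun z => deriv_kummerM_ne_zero hb
  obtain ⟨U, hU, hU0, hUrec⟩ := exists_kummer_riccati (a := a) hb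
  have hS : ∀ n, 1 ≤ n → PowerSeries.coeff n U = -kummerS a b (n + 1) := fun n hn => by
    rw [eq_neg_iff_add_eq_zero, ← eq_neg_iff_add_eq_zero.mp
      (tsum_zpow_zeros_eq_neg_coeff hd h0 hsimple hC0 hM hU hn), add_comm]
    rfl
  have hb0 : b ≠ 0 := by simpa using hb 0
  have hbn : ∀ n : ℕ, (n : ℂ) + b ≠ 0 := fun n => by
    rw [add_comm]
    exact add_natCast_ne_zero hb n
  have hb1 : b + 1 ≠ 0 := by simpa using add_natCast_ne_zero hb 1
  have hb2 : b + 2 ≠ 0 := by simpa using add_natCast_ne_zero hb 2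
  have hb3 : b + 3 ≠ 0 := by simpa using add_natCast_ne_zero hb 3
  have hu0 : PowerSeries.coeff 0 U = a / b := by
    rw [eq_div_iff hb0, mul_comm, hU0]
  have hS2 : kummerS a b 2 = a * (a - b) / (b ^ 2 * (b + 1)) := by
    have h := hUrec 0
    rw [Finset.Nat.antidiagonal_zero, Finset.sum_singleton, hu0, hS 1 le_rfl] at h
    push_cast at h
    field_simp at h ⊢
    linear_combination -h
  have hS3 : kummerS a b 3 = a * (a - b) * (b - 2 * a) / (b ^ 3 * (b + 1) * (b + 2)) := by
    have h := hUrec 1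
    rw [show Finset.HasAntidiagonal.antidiagonal 1 = {(0, 1), (1, 0)} from rfl,
      Finset.sum_pair (by simp)] at h
    simp only at h
    rw [hu0, hS 1 le_rfl, hS 2 one_le_two, hS2] at h
    push_cast at h
    field_simp at h ⊢
    linear_combination -h
  have hrec : ∀ k : ℕ, 3 ≤ k →
      kummerS a b (k + 1) =
        1 / (b * ((k : ℂ) + b)) *
          ((b - 2 * a) * kummerS a b k +
            b * ∑ m ∈ Finset.Icc 2 (k - 1), kummerS a b m * kummerS a b (k - m + 1)) := by
    intro k hk
    obtain ⟨j, rfl⟩ := Nat.exists_eq_add_of_le' hk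
    have h := hUrec (j + 2)
    rw [sum_antidiagonal_eq_sum_Icc (fun i j => PowerSeries.coeff i U * PowerSeries.coeff j U),
      hu0, hS (j + 2) (by omega), hS (j + 2 + 1) (by omega)] at h
    have hsum : ∑ m ∈ Finset.Icc 2 (j + 2),
        PowerSeries.coeff (m - 1) U * PowerSeries.coeff (j + 3 - m) U =
        ∑ m ∈ Finset.Icc 2 (j + 3 - 1), kummerS a b m * kummerS a b (j + 3 - m + 1) := by
      refine Finset.sum_congr rfl fun m hm => ?_
      rw [Finset.mem_Icc] at hm
      rw [hS (m - 1) (by omega), hS (j + 3 - m) (by omega), Nat.sub_add_cancel (by omega)]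
      ring
    rw [hsum] at h
    have hk' := hbn (j + 3)
    push_cast at h hk' ⊢
    field_simp at h ⊢
    linear_combination -h
  refine ⟨hsimple, fun p hp => summable_norm_zpow_zeros hd h0 hC0 hM hp, hS2, hS3, hrec, ?_⟩
  have h := hrec 3 le_rfl
  rw [show Finset.Icc 2 (3 - 1) = {2} from rfl, Finset.sum_singleton, hS2, hS3] at h
  rw [h]
  have hb3' : (3 : ℂ) + b ≠ 0 := by rwa [add_comm]
  push_cast
  field_simp
  ring
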